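/- For an integer $n \ge 1$ let $\mathcal{L}_n$ be the set of Littlewood polynomials of degree $n$, i.e. polynomials $f(z) = a_0 + a_1 z + \dots + a_n z^n$ with $a_j \in \{-1, 1\}$ for all $0 \le j \le n$. A pair $(k, n)$ of integers with $1 \le k \le n-1$ is called Littlewood-admissible if there exists $f \in \mathcal{L}_n$ that has no zeros on the unit circle $|z| = 1$ and exactly $k$ complex zeros, counted with multiplicity, in the open unit disk $|z| < 1$. Theorem 2.5. If $n \ge 3$ is an integer such that $n \le 12$ or $n \not\equiv 1 \pmod 6$, then the pairs $(2, n)$ and $(n-2, n)$ are both Littlewood-admissible. -/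

import Mathlib

open Polynomial

/-- `f` belongs to `𝓛ₙ`: an integer polynomial of degree `n` all of whose coefficients
`a₀, …, aₙ` lie in `{-1, 1}`. -/
def IsLittlewood (n : ℕ) (f : ℤ[X]) : Prop :=
  f.natDegree = n ∧ ∀ j ≤ n, f.coeff j = -1 ∨ f.coeff j = 1

open Classical in
/-- `N(f)`: the number of complex zeros of `f`, with multiplicity, in the open unit disk. -/
noncomputable def numZerosInDisk (f : ℤ[X]) : ℕ :=
  Multiset.card ((f.map (Int.castRingHom ℂ)).roots.filter fun z => ‖z‖ < 1)

open Classical in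
/-- `U(f)`: the number of complex zeros of `f`, with multiplicity, on the unit circle. -/
noncomputable def numZerosOnCircle (f : ℤ[X]) : ℕ :=
  Multiset.card ((f.map (Int.castRingHom ℂ)).roots.filter fun z => ‖z‖ = 1)

/-- A valid pair `(k, n)`, i.e. `1 ≤ k ≤ n - 1`, is Littlewood-admissible if some `f ∈ 𝓛ₙ`
has no zeros on the unit circle and exactly `k` zeros in the open unit disk. -/
def LittlewoodAdmissible (k n : ℕ) : Prop :=
  (1 ≤ k ∧ k + 1 ≤ n) ∧
    ∃ f : ℤ[X], IsLittlewood n f ∧ numZerosOnCircle f = 0 ∧ numZerosInDisk f = k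

/-! Multiplying a nearly periodic Littlewood polynomial `f` by a short `Φ` collapses it to `h - z ^
M * t`, where `h` and `t` have fixed low degree and `h` has exactly two zeros in the open disk. On
the unit circle `Φ * f * conj h` has nonnegative real part, so Rouché's theorem would give `f` two
zeros as well, were it not that `Φ` vanishes at points of the circle. These zeros of `Φ` are the
only points of contact, and `f * conj h` has positive real part there. Replacing `Φ` by `Φ + δ` with
small `δ > 0`, which has no zero in the closed disk, removes the contact
(`diskCount_eq_of_re_nonneg`). The reciprocal polynomial then gives `n - 2`
(`IsLittlewood.admissible`). The choice `Φ = 1 - z` serves even `n`, and `Φ = 1 - z ^ 3` serves `n`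
congruent to 0 or 2 modulo 3. What remains is 1 modulo 6, hence only `n = 7`, where `Φ = 1 + z`
works. -/

/-! ### Argument principle and Rouché's theorem on the unit circle -/

open Classical in
/-- The number of zeros, with multiplicity, of a complex polynomial in the open unit disk. -/
noncomputable def diskCount (p : ℂ[X]) : ℕ :=
  Multiset.card (p.roots.filter fun z => ‖z‖ < 1)

open Classical in
theorem circleIntegral_sub_inv_eq_ite {a : ℂ} (ha : ‖a‖ ≠ 1) :
    (∮ z in C(0, 1), (z - a)⁻¹) = if ‖a‖ < 1 then 2 * Real.pi * Complex.I else 0 := by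
  split_ifs with h
  · exact circleIntegral.integral_sub_inv_of_mem_ball (by simpa using h)
  · have h' : 1 < ‖a‖ := lt_of_le_of_ne (not_lt.1 h) ha.symm
    have hne : ∀ z ∈ Metric.closedBall (0 : ℂ) 1, z - a ≠ 0 := fun z hz h0 => by
      rw [sub_eq_zero] at h0
      subst h0
      simp only [Metric.mem_closedBall, dist_zero_right] at hz
      linarith
    refine DiffContOnCl.circleIntegral_eq_zero zero_le_one (DifferentiableOn.diffContOnCl ?_)
    rw [closure_ball _ one_ne_zero]
    exact fun z hz => ((differentiableAt_id.sub_const a).inv (hne z hz)).differentiableWithinAt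

theorem circleIntegrable_sub_inv {a : ℂ} (ha : ‖a‖ ≠ 1) :
    CircleIntegrable (fun z => (z - a)⁻¹) 0 1 :=
  circleIntegrable_sub_inv_iff.2 (Or.inr (by simpa using ha))

open Classical in
theorem circleIntegral_multiset_sum_inv (s : Multiset ℂ) (hs : ∀ a ∈ s, ‖a‖ ≠ 1) :
    CircleIntegrable (fun z => (s.map fun a => (z - a)⁻¹).sum) 0 1 ∧
      (∮ z in C(0, 1), (s.map fun a => (z - a)⁻¹).sum) =
        2 * Real.pi * Complex.I * Multiset.card (s.filter fun z => ‖z‖ < 1) := by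
  induction s using Multiset.induction_on with
  | empty => simp [circleIntegral]
  | cons a s ih =>
    obtain ⟨hi, he⟩ := ih fun b hb => hs b (Multiset.mem_cons_of_mem hb)
    have ha := hs a (Multiset.mem_cons_self a s)
    have ia := circleIntegrable_sub_inv ha
    simp only [Multiset.map_cons, Multiset.sum_cons]
    refine ⟨ia.add hi, ?_⟩
    rw [circleIntegral.integral_add ia hi, he, circleIntegral_sub_inv_eq_ite ha]
    split_ifs with h
    · rw [Multiset.filter_cons_of_pos (p := fun z : ℂ => ‖z‖ < 1) _ h, Multiset.card_cons]
      push_cast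
      ring
    · rw [Multiset.filter_cons_of_neg (p := fun z : ℂ => ‖z‖ < 1) _ h]
      ring

/-- The argument principle on the unit circle for polynomials. -/
theorem circleIntegral_logDeriv {p : ℂ[X]} (hp : ∀ z : ℂ, ‖z‖ = 1 → p.eval z ≠ 0) :
    CircleIntegrable (fun z => p.derivative.eval z / p.eval z) 0 1 ∧
      (∮ z in C(0, 1), p.derivative.eval z / p.eval z) =
        2 * Real.pi * Complex.I * diskCount p := by
  have hs : ∀ a ∈ p.roots, ‖a‖ ≠ 1 := fun a ha h => hp a h (isRoot_of_mem_roots ha)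
  have he : Set.EqOn (fun z => p.derivative.eval z / p.eval z)
      (fun z => (p.roots.map fun a => (z - a)⁻¹).sum) (Metric.sphere 0 1) := fun z hz => by
    simpa using (IsAlgClosed.splits p).eval_derivative_div_eval_of_ne_zero
      (hp z (by simpa using hz))
  obtain ⟨h1, h2⟩ := circleIntegral_multiset_sum_inv p.roots hs
  refine ⟨(circleIntegrable_congr (by simpa using he)).2 h1, ?_⟩
  rw [circleIntegral.integral_congr zero_le_one he, h2, diskCount]

/-- Rouché's theorem on the unit circle for polynomials, for a quotient with values in the right
half plane. -/
theorem diskCount_eq_of_re_pos {p q : ℂ[X]}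
    (h : ∀ z : ℂ, ‖z‖ = 1 → 0 < (p.eval z * (starRingEnd ℂ) (q.eval z)).re) :
    diskCount p = diskCount q := by
  have hp : ∀ z : ℂ, ‖z‖ = 1 → p.eval z ≠ 0 := fun z hz h0 => by
    have := h z hz
    simp [h0] at this
  have hq : ∀ z : ℂ, ‖z‖ = 1 → q.eval z ≠ 0 := fun z hz h0 => by
    have := h z hz
    simp [h0] at this
  obtain ⟨ip, ep⟩ := circleIntegral_logDeriv hp
  obtain ⟨iq, eq⟩ := circleIntegral_logDeriv hq
  have key : (∮ z in C(0, 1), (p.derivative.eval z / p.eval z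
      - q.derivative.eval z / q.eval z)) = 0 := by
    -- On the circle `p / q` lies in the right half plane, so its principal logarithm is a
    -- single-valued primitive of the integrand.
    refine circleIntegral.integral_eq_zero_of_hasDerivWithinAt
      (f := fun z => Complex.log (p.eval z / q.eval z)) zero_le_one fun z hz => ?_
    have hz : ‖z‖ = 1 := by simpa using hz
    have hmem : p.eval z / q.eval z ∈ Complex.slitPlane := by
      refine Or.inl ?_
      rw [div_eq_mul_inv, Complex.inv_def, ← mul_assoc, Complex.re_mul_ofReal]
      exact mul_pos (h z hz) (inv_pos.2 (Complex.normSq_pos.2 (hq z hz)))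
    have hd := ((p.hasDerivAt z).div (q.hasDerivAt z) (hq z hz)).clog hmem
    refine (hd.congr_deriv ?_).hasDerivWithinAt
    have := hp z hz
    have := hq z hz
    simp only [Pi.div_apply]
    field_simp
  rw [circleIntegral.integral_sub ip iq, ep, eq, ← mul_sub] at key
  have : (2 * Real.pi * Complex.I : ℂ) ≠ 0 := Complex.two_pi_I_ne_zero
  have := (mul_eq_zero.1 key).resolve_left this
  exact_mod_cast sub_eq_zero.1 this

theorem diskCount_mul {p q : ℂ[X]} (h : p * q ≠ 0) :
    diskCount (p * q) = diskCount p + diskCount q := by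
  classical
  simp [diskCount, roots_mul h]

theorem diskCount_eq_zero {p : ℂ[X]} (h : ∀ z : ℂ, ‖z‖ < 1 → p.eval z ≠ 0) : diskCount p = 0 := by
  classical
  rw [diskCount, Multiset.card_eq_zero, Multiset.filter_eq_nil]
  exact fun a ha h1 => h a h1 (isRoot_of_mem_roots ha)

theorem diskCount_X_pow (n : ℕ) : diskCount (X ^ n) = n := by
  classical
  rw [diskCount, roots_X_pow, Multiset.filter_eq_self.2]
  · simp
  · intro a ha
    rw [Multiset.mem_nsmul] at ha
    simp_all

/-! ### Rouché's theorem with contact -/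

/-- On a compact set, a nonnegative function becomes positive after adding a small multiple of a
function which is positive on its zero set. -/
theorem IsCompact.exists_add_mul_pos {α : Type*} [TopologicalSpace α] {K : Set α}
    (hK : IsCompact K) {a b : α → ℝ} (ha : ContinuousOn a K) (hb : ContinuousOn b K)
    (h0 : ∀ x ∈ K, 0 ≤ a x) (h1 : ∀ x ∈ K, a x = 0 → 0 < b x) :
    ∃ δ > 0, ∀ x ∈ K, 0 < a x + δ * b x := by
  rcases K.eq_empty_or_nonempty with rfl | hne
  · exact ⟨1, one_pos, by simp⟩
  obtain ⟨B, hB⟩ := hK.exists_bound_of_continuousOn hb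
  obtain ⟨x₀, hx₀, hmin⟩ := hK.exists_isMinOn hne (ha.sup hb)
  have hm : 0 < max (a x₀) (b x₀) := by
    rcases (h0 x₀ hx₀).eq_or_lt with h | h
    · exact lt_max_of_lt_right (h1 x₀ hx₀ h.symm)
    · exact lt_max_of_lt_left h
  have hB0 : 0 ≤ B := (norm_nonneg _).trans (hB x₀ hx₀)
  -- With `m > 0` the minimum of `max a b` and `|b| ≤ B`, this `δ` satisfies `δ * B < m`. Where `a ≥
  -- m` the perturbation is too small to matter; where `b ≥ m` it is positive.
  refine ⟨max (a x₀) (b x₀) / (2 * (B + 1)), by positivity, fun x hx => ?_⟩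
  set m := max (a x₀) (b x₀)
  have hmx : m ≤ max (a x) (b x) := hmin hx
  rcases le_max_iff.1 hmx with h | h
  · have hb' : -B ≤ b x := (abs_le.1 (hB x hx)).1
    have h2 : m / (2 * (B + 1)) * B < m := by
      rw [div_mul_eq_mul_div, div_lt_iff₀ (by positivity)]
      nlinarith
    have h3 : m / (2 * (B + 1)) * -B ≤ m / (2 * (B + 1)) * b x :=
      mul_le_mul_of_nonneg_left hb' (by positivity)
    linarith
  · have h2 : 0 < m / (2 * (B + 1)) * b x := mul_pos (by positivity) (hm.trans_le h)
    linarith [h0 x hx]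

/-- A form of Rouché's theorem that allows for contact: `Φ * f` may vanish on the unit circle at
zeros of `Φ`. -/
theorem diskCount_eq_of_re_nonneg {f h Φ : ℂ[X]}
    (hΦ : ∀ z : ℂ, ‖z‖ ≤ 1 → 0 ≤ (Φ.eval z).re)
    (h0 : ∀ z : ℂ, ‖z‖ = 1 → 0 ≤ (Φ.eval z * f.eval z * (starRingEnd ℂ) (h.eval z)).re)
    (h1 : ∀ z : ℂ, ‖z‖ = 1 → (Φ.eval z * f.eval z * (starRingEnd ℂ) (h.eval z)).re = 0 →
      0 < (f.eval z * (starRingEnd ℂ) (h.eval z)).re) :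
    (∀ z : ℂ, ‖z‖ = 1 → f.eval z ≠ 0) ∧ diskCount f = diskCount h := by
  have hf : ∀ z : ℂ, ‖z‖ = 1 → f.eval z ≠ 0 := fun z hz h0 => by
    have := h1 z hz (by simp [h0])
    simp [h0] at this
  refine ⟨hf, ?_⟩
  have hc : ∀ p : ℂ[X], Continuous fun z : ℂ => p.eval z := fun p => p.continuous
  obtain ⟨δ, hδ, hpos⟩ := (isCompact_sphere (0 : ℂ) 1).exists_add_mul_pos
    (a := fun z => (Φ.eval z * f.eval z * (starRingEnd ℂ) (h.eval z)).re)
    (b := fun z => (f.eval z * (starRingEnd ℂ) (h.eval z)).re)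
    (by have := hc Φ; have := hc f; have := hc h; fun_prop)
    (by have := hc f; have := hc h; fun_prop)
    (fun z hz => h0 z (by simpa using hz)) (fun z hz => h1 z (by simpa using hz))
  have hne : ∀ z : ℂ, ‖z‖ ≤ 1 → (Φ + C (δ : ℂ)).eval z ≠ 0 := fun z hz he => by
    have := congrArg Complex.re he
    have := hΦ z hz
    simp at *
    linarith
  have hf0 : f ≠ 0 := fun h => hf 1 (by simp) (by simp [h])
  have hΦ0 : Φ + C (δ : ℂ) ≠ 0 := fun h => hne 0 (by simp) (by rw [h]; simp)
  -- The factor `Φ + δ` has real part at least `δ` on the closed disk, so it contributes no zeros to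
  -- the count.
  have e : diskCount ((Φ + C (δ : ℂ)) * f) = diskCount h := by
    refine diskCount_eq_of_re_pos fun z hz => ?_
    have := hpos z (by simpa using hz)
    rw [eval_mul, eval_add, eval_C, add_mul, add_mul, Complex.add_re, mul_assoc (δ : ℂ),
      Complex.re_ofReal_mul]
    exact this
  rw [← e, diskCount_mul (mul_ne_zero hΦ0 hf0), diskCount_eq_zero fun z hz => hne z hz.le, zero_add]
-- Reciprocal polynomials
theorem roots_reverse_multiset_prod {K : Type*} [Field K] (s : Multiset K) (hs : (0 : K) ∉ s) :
    (s.map fun a => X - C a).prod.reverse.roots = s.map fun a => a⁻¹ := by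
  induction s using Multiset.induction_on with
  | empty =>
    rw [Multiset.map_zero, Multiset.prod_zero, ← C_1, reverse_C, roots_C, Multiset.map_zero]
  | cons a s ih =>
    have ha : a ≠ 0 := fun h => hs (h ▸ Multiset.mem_cons_self a s)
    have hs' : (0 : K) ∉ s := fun h => hs (Multiset.mem_cons_of_mem h)
    have hr : (X - C a).reverse = C (-a) * X + C 1 := by
      rw [reverse, natDegree_X_sub_C, reflect_sub, reflect_C, ← pow_one (X : K[X]),
        reflect_monomial]
      simp [revAt_le]
      ring
    have hne : (C (-a) * X + C 1 : K[X]) * (s.map fun a => X - C a).prod.reverse ≠ 0 := by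
      rw [← hr]
      refine mul_ne_zero (reverse_eq_zero.not.2 (X_sub_C_ne_zero a)) (reverse_eq_zero.not.2 ?_)
      exact (monic_multiset_prod_of_monic _ _ fun b _ => monic_X_sub_C b).ne_zero
    rw [Multiset.map_cons, Multiset.prod_cons, reverse_mul_of_domain, hr, roots_mul hne, ih hs',
      Multiset.map_cons, roots_C_mul_X_add_C _ (neg_ne_zero.2 ha), Multiset.singleton_add]
    congr 1
    field_simp

theorem Polynomial.Splits.roots_reverse {K : Type*} [Field K] {p : K[X]} (hp : p.Splits)
    (h0 : p.coeff 0 ≠ 0) : p.reverse.roots = p.roots.map fun a => a⁻¹ := by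
  have hp0 : p ≠ 0 := fun h => h0 (by simp [h])
  have hs : (0 : K) ∉ p.roots := by
    rw [mem_roots hp0, IsRoot, ← coeff_zero_eq_eval_zero]
    exact h0
  conv_lhs => rw [hp.eq_prod_roots]
  rw [reverse_mul_of_domain, reverse_C, roots_C_mul _ (leadingCoeff_ne_zero.2 hp0),
    roots_reverse_multiset_prod _ hs]

theorem reverse_map_of_injective {R S : Type*} [Semiring R] [Semiring S] {φ : R →+* S}
    (hφ : Function.Injective φ) (f : R[X]) : (f.map φ).reverse = f.reverse.map φ := by
  rw [reverse, reverse, natDegree_map_eq_of_injective hφ, reflect_map]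

theorem IsLittlewood.reverse {n : ℕ} {f : ℤ[X]} (hf : IsLittlewood n f) :
    IsLittlewood n f.reverse := by
  obtain ⟨hd, hc⟩ := hf
  have h0 : f.coeff 0 ≠ 0 := by rcases hc 0 n.zero_le with h | h <;> simp [h]
  refine ⟨?_, fun j hj => ?_⟩
  · rw [reverse_natDegree, natTrailingDegree_eq_zero.2 (Or.inr h0), hd, Nat.sub_zero]
  · rw [coeff_reverse, hd, revAt_le hj]
    exact hc _ (Nat.sub_le n j)

/-- A Littlewood polynomial without zeros on the unit circle and with `k` zeros inside, together
with its reciprocal polynomial, shows that `k` and `n - k` are admissible. -/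
theorem IsLittlewood.admissible {n k : ℕ} {f : ℤ[X]} (hf : IsLittlewood n f) (hk : 1 ≤ k)
    (hkn : k + 1 ≤ n) (hU : ∀ z : ℂ, ‖z‖ = 1 → (f.map (Int.castRingHom ℂ)).eval z ≠ 0)
    (hN : diskCount (f.map (Int.castRingHom ℂ)) = k) :
    LittlewoodAdmissible k n ∧ LittlewoodAdmissible (n - k) n := by
  classical
  set p := f.map (Int.castRingHom ℂ) with hp
  have hinj : Function.Injective (Int.castRingHom ℂ) := Int.cast_injective
  have h0 : p.coeff 0 ≠ 0 := by
    rcases hf.2 0 n.zero_le with h | h <;> simp [hp, h]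
  have hs : p.Splits := IsAlgClosed.splits p
  have hroots : (f.reverse.map (Int.castRingHom ℂ)).roots = p.roots.map fun a => a⁻¹ := by
    rw [← reverse_map_of_injective hinj, hs.roots_reverse h0]
  have hU' : ∀ a ∈ p.roots, ‖a‖ ≠ 1 := fun a ha h => hU a h (isRoot_of_mem_roots ha)
  have hz : ∀ a ∈ p.roots, a ≠ 0 := fun a ha h => by
    have := isRoot_of_mem_roots ha
    rw [h, IsRoot, ← coeff_zero_eq_eval_zero] at this
    exact h0 this
  refine ⟨⟨⟨hk, hkn⟩, f, hf, ?_, ?_⟩, ⟨⟨by omega, by omega⟩, f.reverse, hf.reverse, ?_, ?_⟩⟩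
  · rw [numZerosOnCircle, Multiset.card_eq_zero, Multiset.filter_eq_nil]
    exact hU'
  · rw [← hN, numZerosInDisk, diskCount]
  · rw [numZerosOnCircle, hroots, Multiset.card_eq_zero, Multiset.filter_eq_nil]
    intro b hb
    obtain ⟨a, ha, rfl⟩ := Multiset.mem_map.1 hb
    rw [norm_inv, inv_eq_one]
    exact hU' a ha
  · rw [numZerosInDisk, hroots, Multiset.filter_map, Multiset.card_map]
    have hcard : Multiset.card p.roots = n := by
      rw [← hs.natDegree_eq_card_roots, hp, natDegree_map_eq_of_injective hinj, hf.1]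
    have hadd := congrArg Multiset.card (Multiset.filter_add_not (fun z : ℂ => ‖z‖ < 1) p.roots)
    -- Inversion exchanges the inside and the outside of the circle, and no zero lies on the circle
    -- itself.
    have hcongr : p.roots.filter ((fun z : ℂ => ‖z‖ < 1) ∘ fun a => a⁻¹) =
        p.roots.filter fun z => ¬ ‖z‖ < 1 := by
      refine Multiset.filter_congr fun a ha => ?_
      rw [Function.comp_apply, norm_inv, inv_lt_one₀ (norm_pos_iff.2 (hz a ha)), not_lt]
      exact ⟨le_of_lt, fun h => lt_of_le_of_ne h (hU' a ha).symm⟩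
    have hN' : Multiset.card (p.roots.filter fun z => ‖z‖ < 1) = k := by
      rw [← hN, diskCount]
    rw [Multiset.card_add, hcard, hN'] at hadd
    rw [hcongr]
    omega

/-! ### Explicit Littlewood polynomials and identities on the unit circle -/

/-- The integer polynomial of degree at most `n` with coefficients `a 0, …, a n`. -/
noncomputable def ofCoeffs (n : ℕ) (a : ℕ → ℤ) : ℤ[X] :=
  ∑ j ∈ Finset.range (n + 1), C (a j) * X ^ j

theorem isLittlewood_ofCoeffs {n : ℕ} {a : ℕ → ℤ} (ha : ∀ j, a j = -1 ∨ a j = 1) :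
    IsLittlewood n (ofCoeffs n a) := by
  have hc : ∀ j, (ofCoeffs n a).coeff j = if j < n + 1 then a j else 0 := fun j => by
    simp [ofCoeffs, coeff_X_pow]
  refine ⟨le_antisymm ?_ ?_, fun j hj => ?_⟩
  · refine natDegree_le_iff_coeff_eq_zero.2 fun j hj => ?_
    rw [hc, if_neg (by omega)]
  · refine le_natDegree_of_ne_zero ?_
    rw [hc, if_pos (Nat.lt_succ_self n)]
    rcases ha n with h | h <;> simp [h]
  · rw [hc, if_pos (by omega)]
    exact ha j

theorem eval_map_ofCoeffs (n : ℕ) (a : ℕ → ℤ) (z : ℂ) :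
    ((ofCoeffs n a).map (Int.castRingHom ℂ)).eval z =
      ∑ j ∈ Finset.range (n + 1), (a j : ℂ) * z ^ j := by
  simp [ofCoeffs, Polynomial.map_sum, eval_finsetSum]

theorem inv_eq_conj_of_norm_eq_one {z : ℂ} (hz : ‖z‖ = 1) : (starRingEnd ℂ) z = z⁻¹ := by
  rw [Complex.inv_def, Complex.normSq_eq_norm_sq, hz]
  simp

/-- Polarization. If `|t| ≤ |h|`, the right side is nonnegative, and it vanishes only when `h = t`:
this locates the points of contact. -/
theorem two_mul_re_sub_mul_conj (h t : ℂ) :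
    2 * ((h - t) * (starRingEnd ℂ) h).re =
      Complex.normSq h - Complex.normSq t + Complex.normSq (h - t) := by
  simp only [Complex.normSq_apply, Complex.mul_re, Complex.sub_re, Complex.sub_im,
    Complex.conj_re, Complex.conj_im]
  ring

theorem normSq_pow_mul_of_norm_eq_one {z : ℂ} (hz : ‖z‖ = 1) (M : ℕ) (t : ℂ) :
    Complex.normSq (z ^ M * t) = Complex.normSq t := by
  simp [Complex.normSq_eq_norm_sq, hz]

theorem diskCount_X_sq_mul {c : ℂ[X]} (hc : ∀ z : ℂ, ‖z‖ < 1 → c.eval z ≠ 0) :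
    diskCount (X ^ 2 * c) = 2 := by
  have h0 : c ≠ 0 := fun h => hc 0 (by simp) (by simp [h])
  rw [diskCount_mul (mul_ne_zero (pow_ne_zero 2 X_ne_zero) h0), diskCount_X_pow,
    diskCount_eq_zero hc]
-- Reduces a real part on the circle to a rational identity in `z`, since there `conj z = z⁻¹` and
-- `re z = (z + z⁻¹) / 2`.
theorem re_eq_of_two_mul_eq_add_conj {w : ℂ} {r : ℝ} (h : w + (starRingEnd ℂ) w = 2 * r) :
    w.re = r := by
  rw [Complex.add_conj] at h
  have : (2 * w.re : ℝ) = 2 * r := by exact_mod_cast h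
  linarith

theorem re_eq_add_inv_div_two {z : ℂ} (hz : ‖z‖ = 1) : (z.re : ℂ) = (z + z⁻¹) / 2 := by
  rw [← inv_eq_conj_of_norm_eq_one hz, Complex.add_conj]
  push_cast
  ring

theorem sq_re_le_one {z : ℂ} (hz : ‖z‖ = 1) : z.re ^ 2 ≤ 1 := by
  have := Complex.abs_re_le_norm z
  rw [hz] at this
  exact (sq_le_one_iff_abs_le_one _).2 this

theorem re_one_sub_X_pow_nonneg (k : ℕ) (z : ℂ) (hz : ‖z‖ ≤ 1) :
    0 ≤ ((1 - X ^ k : ℂ[X]).eval z).re := by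
  have : (z ^ k).re ≤ 1 :=
    (Complex.re_le_norm _).trans (by rw [norm_pow]; exact pow_le_one₀ (norm_nonneg z) hz)
  simpa using this

theorem eq_one_of_norm_le_of_re_eq {w : ℂ} (hw : ‖w‖ = 1) (h : w.re = 1) : w = 1 := by
  have h1 : w.re * w.re + w.im * w.im = 1 := by
    rw [← Complex.normSq_apply, Complex.normSq_eq_norm_sq, hw, one_pow]
  have h2 : w.im = 0 := by
    rw [h] at h1
    nlinarith
  exact Complex.ext (by simpa using h) (by simpa using h2)

/-! ### Even degrees -/

theorem diskCount_one_sub_two_X_sq : diskCount (1 - 2 * X ^ 2 : ℂ[X]) = 2 := by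
  refine (diskCount_eq_of_re_pos fun z hz => ?_).trans (diskCount_X_sq_mul (c := -1) (by simp))
  have e : (eval z (1 - 2 * X ^ 2) * (starRingEnd ℂ) (eval z (X ^ 2 * -1))).re =
      3 - 2 * z.re ^ 2 := by
    refine re_eq_of_two_mul_eq_add_conj ?_
    push_cast
    have hz0 : z ≠ 0 := fun h => by simp [h] at hz
    simp [map_ofNat, inv_eq_conj_of_norm_eq_one hz, re_eq_add_inv_div_two hz]
    field_simp
    ring
  rw [e]
  linarith [sq_re_le_one hz]

/-- The coefficients `1, 1, -1, -1, -1, …`. -/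
def evenCoeff (j : ℕ) : ℤ := if j < 2 then 1 else -1

theorem evenCoeff_sum_mul (n : ℕ) (z : ℂ) :
    (1 - z) * ∑ j ∈ Finset.range (n + 2), (evenCoeff j : ℂ) * z ^ j =
      1 - 2 * z ^ 2 + z ^ (n + 2) := by
  induction n with
  | zero =>
    simp [Finset.sum_range_succ, evenCoeff]
    ring
  | succ n ih =>
    rw [Finset.sum_range_succ, mul_add, ih]
    simp [evenCoeff]
    ring

theorem evenCoeff_sum_one (n : ℕ) :
    ∑ j ∈ Finset.range (n + 2), (evenCoeff j : ℂ) = 2 - n := by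
  induction n with
  | zero =>
    simp [Finset.sum_range_succ, evenCoeff]
    norm_num
  | succ n ih =>
    rw [Finset.sum_range_succ, ih]
    simp [evenCoeff]
    ring

theorem admissible_of_even {n : ℕ} (hn : 3 ≤ n) (he : Even n) :
    LittlewoodAdmissible 2 n ∧ LittlewoodAdmissible (n - 2) n := by
  obtain ⟨m, rfl⟩ : ∃ m, n = m + 1 := ⟨n - 1, by omega⟩
  have hf : IsLittlewood (m + 1) (ofCoeffs (m + 1) evenCoeff) :=
    isLittlewood_ofCoeffs fun j => by unfold evenCoeff; split_ifs <;> simp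
  have key := diskCount_eq_of_re_nonneg
    (f := (ofCoeffs (m + 1) evenCoeff).map (Int.castRingHom ℂ)) (h := 1 - 2 * X ^ 2)
    (Φ := 1 - X ^ 1) (re_one_sub_X_pow_nonneg 1) ?_ ?_
  · exact hf.admissible one_le_two (by omega) key.1 (key.2.trans diskCount_one_sub_two_X_sq)
  all_goals
    intro z hz
    have hz0 : z ≠ 0 := fun h => by simp [h] at hz
    have e : 2 * (eval z (1 - X ^ 1) *
        eval z ((ofCoeffs (m + 1) evenCoeff).map (Int.castRingHom ℂ)) *
        (starRingEnd ℂ) (eval z (1 - 2 * X ^ 2))).re =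
        8 * (1 - z.re ^ 2) + Complex.normSq (1 - 2 * z ^ 2 + z ^ (m + 2)) := by
      have h1 : eval z (1 - X ^ 1) *
          eval z ((ofCoeffs (m + 1) evenCoeff).map (Int.castRingHom ℂ)) =
          (1 - 2 * z ^ 2) - z ^ (m + 2) * (-1) := by
        rw [eval_map_ofCoeffs]
        simp only [eval_sub, eval_one, eval_X, pow_one]
        rw [evenCoeff_sum_mul]
        ring
      have h2 : eval z (1 - 2 * X ^ 2) = 1 - 2 * z ^ 2 := by simp
      have h3 : Complex.normSq (1 - 2 * z ^ 2) = 9 - 8 * z.re ^ 2 := by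
        have : (Complex.normSq (1 - 2 * z ^ 2) : ℂ) = 9 - 8 * z.re ^ 2 := by
          rw [Complex.normSq_eq_conj_mul_self, re_eq_add_inv_div_two hz]
          simp [map_ofNat, inv_eq_conj_of_norm_eq_one hz]
          field_simp
          ring
        exact_mod_cast this
      rw [h1, h2, two_mul_re_sub_mul_conj, normSq_pow_mul_of_norm_eq_one hz, h3]
      simp
      ring
    have hx := sq_re_le_one hz
  · linarith [Complex.normSq_nonneg (1 - 2 * z ^ 2 + z ^ (m + 2))]
  · intro h0
    rw [h0] at e
    have hns := Complex.normSq_nonneg (1 - 2 * z ^ 2 + z ^ (m + 2))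
    have h1 : Complex.normSq (1 - 2 * z ^ 2 + z ^ (m + 2)) = 0 := by linarith
    have h2 : z.re ^ 2 = 1 := by linarith
    have h3 : z = 1 := by
      rcases mul_self_eq_one_iff.1 ((sq z.re).symm.trans h2) with h | h
      · exact eq_one_of_norm_le_of_re_eq hz h
      · have hneg : -z = 1 := eq_one_of_norm_le_of_re_eq (by simpa using hz) (by simp [h])
        have hz' : z = -1 := by rw [← hneg, neg_neg]
        -- Evenness of the degree `m + 1` excludes contact at `-1`, where `1 - 2 * z ^ 2 + z ^ (m +
        -- 2)` equals `-2`.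
        have hodd : Odd (m + 2) := by grind
        rw [Complex.normSq_eq_zero, hz', hodd.neg_one_pow] at h1
        norm_num at h1
    subst h3
    -- At the contact point 1 the values are `f = 2 - m` and `h = -1`, so positivity needs `m > 2`.
    have hm : (3 : ℝ) ≤ m := by
      have : 3 ≤ m := by grind
      exact_mod_cast this
    rw [eval_map_ofCoeffs]
    simp only [one_pow, mul_one, evenCoeff_sum_one]
    simp
    linarith
/-! ### Degrees that are not congruent to `1` modulo `3` -/

theorem diskCount_cubic : diskCount (1 + X + X ^ 2 - 2 * X ^ 3 : ℂ[X]) = 2 := by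
  -- The comparison polynomial is `z ^ 2 * (5 - 4 * z)`: its zero `5 / 4` approximates the real zero
  -- of the cubic, which lies between `6 / 5` and `5 / 4`.
  have hc : ∀ z : ℂ, ‖z‖ < 1 → (5 - 4 * X : ℂ[X]).eval z ≠ 0 := fun z hz h => by
    have h1 : (4 : ℂ) * z = 5 := by
      simp at h
      linear_combination -h
    have h2 := congrArg norm h1
    simp at h2
    linarith
  refine (diskCount_eq_of_re_pos fun z hz => ?_).trans (diskCount_X_sq_mul hc)
  have e : (eval z (1 + X + X ^ 2 - 2 * X ^ 3) *
      (starRingEnd ℂ) (eval z (X ^ 2 * (5 - 4 * X)))).re =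
      12 + 3 * z.re + 2 * z.re ^ 2 - 16 * z.re ^ 3 := by
    refine re_eq_of_two_mul_eq_add_conj ?_
    push_cast
    have hz0 : z ≠ 0 := fun h => by simp [h] at hz
    simp [map_ofNat, inv_eq_conj_of_norm_eq_one hz, re_eq_add_inv_div_two hz]
    field_simp
    ring
  rw [e]
  have hx := abs_le.1 ((sq_le_one_iff_abs_le_one _).1 (sq_re_le_one hz))
  have h1 : 0 ≤ 1 - z.re := by linarith
  -- With `x = re z`, `(1 - x) * (4 * x + 2) ^ 2 = 4 + 12 * x - 16 * x ^ 3`, which leaves `8 - 9 * x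
  -- + 2 * x ^ 2`, positive for `x ≤ 1`.
  nlinarith [mul_nonneg h1 (sq_nonneg (4 * z.re + 2)), sq_nonneg z.re]

theorem eq_one_or_of_pow_three_eq_one {z : ℂ} (h : z ^ 3 = 1) : z = 1 ∨ z ^ 2 = -1 - z := by
  have : (z - 1) * (z ^ 2 + z + 1) = 0 := by linear_combination h
  rcases mul_eq_zero.1 this with h | h
  · exact Or.inl (sub_eq_zero.1 h)
  · exact Or.inr (by linear_combination h)

/-- On the circle `|h| ^ 2 - |t| ^ 2 = 4 - 4 * re (z ^ 3)` for `h = 1 + z + z ^ 2 - 2 * z ^ 3`, so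
contact is confined to cube roots of unity. Only the modulus of `t` matters, which lets one
statement serve two residues modulo 3. -/
theorem diskCount_eq_two_of_one_sub_X_pow_three_mul {f : ℂ[X]} {M : ℕ} {t : ℂ → ℂ}
    (ht : ∀ z : ℂ, ‖z‖ = 1 → Complex.normSq (t z) = Complex.normSq (1 + z - z ^ 2))
    (hf : ∀ z : ℂ, (1 - z ^ 3) * f.eval z = 1 + z + z ^ 2 - 2 * z ^ 3 - z ^ M * t z)
    (h0 : ∀ z : ℂ, z ^ 3 = 1 →
      0 < (f.eval z * (starRingEnd ℂ) (1 + z + z ^ 2 - 2 * z ^ 3)).re) :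
    (∀ z : ℂ, ‖z‖ = 1 → f.eval z ≠ 0) ∧ diskCount f = 2 := by
  rw [← diskCount_cubic]
  have e : ∀ z : ℂ, ‖z‖ = 1 → 4 - 4 * (z ^ 3).re ≤ 2 * (eval z (1 - X ^ 3) * eval z f *
      (starRingEnd ℂ) (eval z (1 + X + X ^ 2 - 2 * X ^ 3))).re := fun z hz => by
    have h1 : eval z (1 - X ^ 3) * eval z f = 1 + z + z ^ 2 - 2 * z ^ 3 - z ^ M * t z := by
      rw [← hf]
      simp
    have h2 : eval z (1 + X + X ^ 2 - 2 * X ^ 3) = 1 + z + z ^ 2 - 2 * z ^ 3 := by simp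
    have h3 : Complex.normSq (1 + z + z ^ 2 - 2 * z ^ 3) - Complex.normSq (1 + z - z ^ 2) =
        4 - 4 * (z ^ 3).re := by
      have hz0 : z ≠ 0 := fun h => by simp [h] at hz
      have : (Complex.normSq (1 + z + z ^ 2 - 2 * z ^ 3) : ℂ) -
          Complex.normSq (1 + z - z ^ 2) = 4 - 4 * (z ^ 3).re := by
        rw [Complex.normSq_eq_conj_mul_self, Complex.normSq_eq_conj_mul_self,
          re_eq_add_inv_div_two (z := z ^ 3) (by simp [hz])]
        simp [map_ofNat, inv_eq_conj_of_norm_eq_one hz]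
        field_simp
        ring
      exact_mod_cast this
    rw [h1, h2, two_mul_re_sub_mul_conj, normSq_pow_mul_of_norm_eq_one hz, ht z hz, h3]
    exact le_add_of_nonneg_right (Complex.normSq_nonneg _)
  have hre : ∀ z : ℂ, ‖z‖ = 1 → (z ^ 3).re ≤ 1 := fun z hz =>
    (Complex.re_le_norm _).trans_eq (by simp [hz])
  refine diskCount_eq_of_re_nonneg (re_one_sub_X_pow_nonneg 3) (fun z hz => ?_) fun z hz h => ?_
  · linarith [e z hz, hre z hz]
  · have h1 := e z hz
    rw [h] at h1
    have h2 : z ^ 3 = 1 :=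
      eq_one_of_norm_le_of_re_eq (by simp [hz]) (le_antisymm (hre z hz) (by linarith))
    simpa using h0 z h2

/-- The coefficients `1, 1, 1, -1, 1, 1, -1, …`. -/
def ternaryCoeff (j : ℕ) : ℤ := if j % 3 = 0 ∧ j ≠ 0 then -1 else 1

theorem isLittlewood_ternaryCoeff (n : ℕ) : IsLittlewood n (ofCoeffs n ternaryCoeff) :=
  isLittlewood_ofCoeffs fun j => by unfold ternaryCoeff; split_ifs <;> simp

theorem ternaryCoeff_sum_step (m : ℕ) (z : ℂ) :
    ∑ j ∈ Finset.range (3 * (m + 1) + 1), (ternaryCoeff j : ℂ) * z ^ j =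
      ∑ j ∈ Finset.range (3 * m + 1), (ternaryCoeff j : ℂ) * z ^ j +
        z ^ (3 * m) * (z + z ^ 2 - z ^ 3) := by
  have h1 : ternaryCoeff (3 * m + 1) = 1 := if_neg (by omega)
  have h2 : ternaryCoeff (3 * m + 2) = 1 := if_neg (by omega)
  have h3 : ternaryCoeff (3 * m + 3) = -1 := if_pos (by omega)
  rw [show 3 * (m + 1) + 1 = 3 * m + 1 + 1 + 1 + 1 by ring, Finset.sum_range_succ,
    Finset.sum_range_succ, Finset.sum_range_succ, h1, h2, h3]
  push_cast
  ring

theorem ternaryCoeff_sum_add_two (m : ℕ) (z : ℂ) :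
    ∑ j ∈ Finset.range (3 * m + 2 + 1), (ternaryCoeff j : ℂ) * z ^ j =
      ∑ j ∈ Finset.range (3 * m + 1), (ternaryCoeff j : ℂ) * z ^ j +
        z ^ (3 * m) * (z + z ^ 2) := by
  have h1 : ternaryCoeff (3 * m + 1) = 1 := if_neg (by omega)
  have h2 : ternaryCoeff (3 * m + 2) = 1 := if_neg (by omega)
  rw [Finset.sum_range_succ, Finset.sum_range_succ, h1, h2]
  push_cast
  ring

theorem ternaryCoeff_sum_mul (m : ℕ) (z : ℂ) :
    (1 - z ^ 3) * ∑ j ∈ Finset.range (3 * m + 1), (ternaryCoeff j : ℂ) * z ^ j =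
      1 + z + z ^ 2 - 2 * z ^ 3 - z ^ (3 * m + 1) * (1 + z - z ^ 2) := by
  induction m with
  | zero =>
    simp [ternaryCoeff]
    ring
  | succ m ih =>
    rw [ternaryCoeff_sum_step, mul_add, ih]
    ring

theorem ternaryCoeff_sum_of_pow_three_eq_one (m : ℕ) {z : ℂ} (hz : z ^ 3 = 1) :
    ∑ j ∈ Finset.range (3 * m + 1), (ternaryCoeff j : ℂ) * z ^ j = 1 + m * (z + z ^ 2 - 1) := by
  induction m with
  | zero => simp [ternaryCoeff]
  | succ m ih =>
    rw [ternaryCoeff_sum_step, ih, pow_mul, hz, one_pow]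
    push_cast
    ring

theorem admissible_of_mod_three_eq_zero {m : ℕ} (hm : 1 ≤ m) :
    LittlewoodAdmissible 2 (3 * m) ∧ LittlewoodAdmissible (3 * m - 2) (3 * m) := by
  have key := diskCount_eq_two_of_one_sub_X_pow_three_mul
    (f := (ofCoeffs (3 * m) ternaryCoeff).map (Int.castRingHom ℂ)) (M := 3 * m + 1)
    (t := fun z => 1 + z - z ^ 2) (fun z _ => rfl)
    (fun z => by rw [eval_map_ofCoeffs, ternaryCoeff_sum_mul]) fun z hz => ?_
  · exact (isLittlewood_ternaryCoeff _).admissible one_le_two (by omega) key.1 key.2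
  · have hm' : (1 : ℝ) ≤ m := by exact_mod_cast hm
    rw [eval_map_ofCoeffs, ternaryCoeff_sum_of_pow_three_eq_one m hz, hz]
    rcases eq_one_or_of_pow_three_eq_one hz with rfl | h
    · norm_num
      linarith
    -- At a primitive cube root of unity both values are real and negative: `f = 1 - 2 * m` and `h =
    -- -2`.
    · rw [h, show (1 : ℂ) + m * (z + (-1 - z) - 1) = ((1 - 2 * m : ℝ) : ℂ) by push_cast; ring,
        Complex.re_ofReal_mul, show 1 + z + (-1 - z) - 2 * 1 = (-2 : ℂ) by ring]
      simp [map_ofNat]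
      linarith

theorem admissible_of_mod_three_eq_two {m : ℕ} (hm : 1 ≤ m) :
    LittlewoodAdmissible 2 (3 * m + 2) ∧ LittlewoodAdmissible (3 * m + 2 - 2) (3 * m + 2) := by
  have key := diskCount_eq_two_of_one_sub_X_pow_three_mul
    (f := (ofCoeffs (3 * m + 2) ternaryCoeff).map (Int.castRingHom ℂ)) (M := 3 * m + 3)
    -- This is the reciprocal polynomial of `1 + z - z ^ 2`, up to no sign, hence of equal modulus
    -- on the circle.
    (t := fun z => z ^ 2 + z - 1) (fun z hz => ?_)
    (fun z => by
      rw [eval_map_ofCoeffs, ternaryCoeff_sum_add_two, mul_add, ternaryCoeff_sum_mul]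
      ring) fun z hz => ?_
  · exact (isLittlewood_ternaryCoeff _).admissible one_le_two (by omega) key.1 key.2
  · have hz0 : z ≠ 0 := fun h => by simp [h] at hz
    have : (Complex.normSq (z ^ 2 + z - 1) : ℂ) = Complex.normSq (1 + z - z ^ 2) := by
      rw [Complex.normSq_eq_conj_mul_self, Complex.normSq_eq_conj_mul_self]
      simp [inv_eq_conj_of_norm_eq_one hz]
      field_simp
    exact_mod_cast this
  · have hm' : (1 : ℝ) ≤ m := by exact_mod_cast hm
    rw [eval_map_ofCoeffs, ternaryCoeff_sum_add_two, ternaryCoeff_sum_of_pow_three_eq_one m hz,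
      pow_mul, hz, one_pow, one_mul]
    rcases eq_one_or_of_pow_three_eq_one hz with rfl | h
    · norm_num
      linarith
    · rw [h, show (1 : ℂ) + m * (z + (-1 - z) - 1) + (z + (-1 - z)) = ((-2 * m : ℝ) : ℂ) by
          push_cast; ring,
        Complex.re_ofReal_mul, show 1 + z + (-1 - z) - 2 * 1 = (-2 : ℂ) by ring]
      simp [map_ofNat]
      linarith

/-! ### Degree seven -/

theorem diskCount_quadratic : diskCount (1 + 2 * X + 2 * X ^ 2 : ℂ[X]) = 2 := by
  refine (diskCount_eq_of_re_pos fun z hz => ?_).trans (diskCount_X_sq_mul (c := 1) (by simp))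
  have e : (eval z (1 + 2 * X + 2 * X ^ 2) * (starRingEnd ℂ) (eval z (X ^ 2 * 1))).re =
      1 + 2 * z.re + 2 * z.re ^ 2 := by
    refine re_eq_of_two_mul_eq_add_conj ?_
    push_cast
    have hz0 : z ≠ 0 := fun h => by simp [h] at hz
    simp [map_ofNat, inv_eq_conj_of_norm_eq_one hz, re_eq_add_inv_div_two hz]
    field_simp
    ring
  rw [e]
  nlinarith [sq_nonneg (2 * z.re + 1)]

/-- Positivity on `[-1, 1]`, read off from the Bernstein coefficients on intervals of length
`1 / 2`. -/
theorem septic_pos {x : ℝ} (h1 : -1 ≤ x) (h2 : x ≤ 1) :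
    0 < 6 + 20 * x - 16 * x ^ 2 - 96 * x ^ 3 + 32 * x ^ 4 + 192 * x ^ 5 - 128 * x ^ 7 := by
  have key : ∀ u v : ℝ, 0 ≤ u → 0 ≤ v → u + v = 1 / 2 → ∀ a b c d e f g h : ℝ, 0 < a → 0 < b →
      0 < c → 0 < d → 0 < e → 0 < f → 0 < g → 0 < h →
      0 < a * v ^ 7 + b * u * v ^ 6 + c * u ^ 2 * v ^ 5 + d * u ^ 3 * v ^ 4 + e * u ^ 4 * v ^ 3 +
        f * u ^ 5 * v ^ 2 + g * u ^ 6 * v + h * u ^ 7 := by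
    intro u v hu hv huv a b c d e f g h ha hb hc hd he hf hg hh
    rcases hu.eq_or_lt with rfl | hu
    · have : v = 1 / 2 := by linarith
      subst this
      positivity
    -- Here `v` may vanish; the term `h * u ^ 7` secures strictness.
    · positivity
  rcases le_total x 0 with h0 | h0
  · rcases le_total x (-1 / 2) with hx | hx
    · have := key (x + 1) (-1 / 2 - x) (by linarith) (by linarith) (by ring)
        34 88 122 132 100 44 10 1 (by norm_num) (by norm_num) (by norm_num) (by norm_num)
        (by norm_num) (by norm_num) (by norm_num) (by norm_num)
      nlinarith [this]
    · have := key (x + 1 / 2) (-x) (by linarith) (by linarith) (by ring)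
        1 4 8 20 52 62 32 6 (by norm_num) (by norm_num) (by norm_num) (by norm_num)
        (by norm_num) (by norm_num) (by norm_num) (by norm_num)
      nlinarith [this]
  · rcases le_total x (1 / 2) with hx | hx
    · have := key x (1 / 2 - x) (by linarith) (by linarith) (by ring)
        6 52 182 328 324 176 52 7 (by norm_num) (by norm_num) (by norm_num) (by norm_num)
        (by norm_num) (by norm_num) (by norm_num) (by norm_num)
      nlinarith [this]
    · have := key (x - 1 / 2) (1 - x) (by linarith) (by linarith) (by ring)
        7 46 140 276 376 314 124 10 (by norm_num) (by norm_num) (by norm_num) (by norm_num)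
        (by norm_num) (by norm_num) (by norm_num) (by norm_num)
      nlinarith [this]

/-- The coefficients `1, 1, 1, -1, 1, -1, 1, -1` for `j ≤ 7`. -/
def septicCoeff (j : ℕ) : ℤ := if j = 3 ∨ j = 5 ∨ j = 7 then -1 else 1

theorem septicCoeff_sum (z : ℂ) :
    ∑ j ∈ Finset.range (7 + 1), (septicCoeff j : ℂ) * z ^ j =
      1 + z + z ^ 2 - z ^ 3 + z ^ 4 - z ^ 5 + z ^ 6 - z ^ 7 := by
  simp [Finset.sum_range_succ, septicCoeff]
  ring

theorem admissible_seven : LittlewoodAdmissible 2 7 ∧ LittlewoodAdmissible (7 - 2) 7 := by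
  have hf : IsLittlewood 7 (ofCoeffs 7 septicCoeff) :=
    isLittlewood_ofCoeffs fun j => by unfold septicCoeff; split_ifs <;> simp
  have key := diskCount_eq_of_re_nonneg
    (f := (ofCoeffs 7 septicCoeff).map (Int.castRingHom ℂ)) (h := 1 + 2 * X + 2 * X ^ 2)
    (Φ := 1 + X) (fun z hz => ?_) ?_ ?_
  · exact hf.admissible one_le_two (by norm_num) key.1 (key.2.trans diskCount_quadratic)
  · have := (abs_le.1 ((Complex.abs_re_le_norm z).trans hz)).1
    simp
    linarith
  all_goals
    intro z hz
    -- Here `(1 + z) * f = h - z ^ 8`, but `|h| ^ 2 = 5 + 12 * x + 8 * x ^ 2` with `x = re z` drops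
    -- to `1 / 2` at `x = -3 / 4`. Comparing moduli fails, so the real part is computed in full.
    have e : (eval z (1 + X) * eval z ((ofCoeffs 7 septicCoeff).map (Int.castRingHom ℂ)) *
        (starRingEnd ℂ) (eval z (1 + 2 * X + 2 * X ^ 2))).re =
        (1 + z.re) * (6 + 20 * z.re - 16 * z.re ^ 2 - 96 * z.re ^ 3 + 32 * z.re ^ 4 +
          192 * z.re ^ 5 - 128 * z.re ^ 7) := by
      refine re_eq_of_two_mul_eq_add_conj ?_
      rw [eval_map_ofCoeffs, septicCoeff_sum]
      push_cast
      have hz0 : z ≠ 0 := fun h => by simp [h] at hz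
      simp [map_ofNat, inv_eq_conj_of_norm_eq_one hz, re_eq_add_inv_div_two hz]
      field_simp
      ring
    have hx := abs_le.1 ((sq_le_one_iff_abs_le_one _).1 (sq_re_le_one hz))
    have hpos := septic_pos hx.1 hx.2
    rw [e]
  · exact mul_nonneg (by linarith) hpos.le
  · intro h
    have h1 : z.re = -1 := by linarith [(mul_eq_zero.1 h).resolve_right hpos.ne']
    have h2 : -z = 1 := eq_one_of_norm_le_of_re_eq (by simpa using hz) (by simp [h1])
    have h3 : z = -1 := by rw [← h2, neg_neg]
    rw [h3, eval_map_ofCoeffs, septicCoeff_sum]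
    simp
    norm_num

theorem theorem2p5 (n : ℕ) (hn : 3 ≤ n) (h : n ≤ 12 ∨ ¬ n ≡ 1 [MOD 6]) :
    LittlewoodAdmissible 2 n ∧ LittlewoodAdmissible (n - 2) n := by
  rcases Nat.even_or_odd n with he | ho
  · exact admissible_of_even hn he
  · have h2 := Nat.odd_iff.1 ho
    have h3 : n % 3 = 0 ∨ n % 3 = 1 ∨ n % 3 = 2 := by omega
    rcases h3 with h3 | h3 | h3
    · obtain ⟨m, rfl⟩ : ∃ m, n = 3 * m := ⟨n / 3, by omega⟩
      exact admissible_of_mod_three_eq_zero (by omega)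
    -- An odd `n` that is 1 modulo 3 is 1 modulo 6, so `n ≤ 12`.
    · have : n = 7 := by
        have h6 : n % 6 = 1 := by omega
        have := h.resolve_right (not_not.2 h6)
        omega
      subst this
      exact admissible_seven
    · obtain ⟨m, rfl⟩ : ∃ m, n = 3 * m + 2 := ⟨n / 3, by omega⟩
      exact admissible_of_mod_three_eq_two (by omega)
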